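/- Let $F_1,\dots,F_m\in\mathbb C[z_1,\dots,z_n]$, let $d_j\ge\deg F_j$ (for instance $d_j=\deg F_j$), let $f_j(z_0,z_1,\dots,z_n)=z_0^{d_j}F_j(z_1/z_0,\dots,z_n/z_0)$ be the $d_j$-homogenization of $F_j$, and let $$Z=\{[z]\in\mathbb P^n(\mathbb C):\ f_1(z)=\dots=f_m(z)=0\}$$ be the projective zero set of $F_1,\dots,F_m$. Assume that $Z$ has codimension $m$ in $\mathbb P^n$ (in particular $Z\neq\emptyset$) and that no irreducible component of $Z$ is contained in the hyperplane at infinity $\{z_0=0\}$. If a polynomial $\Phi\in\mathbb C[z_1,\dots,z_n]$ belongs to the ideal $(F_1,\dots,F_m)$, then there are polynomials $Q_1,\dots,Q_m\in\mathbb C[z_1,\dots,z_n]$ such that $$\Phi=\sum_{j=1}^m F_jQ_j\qquad\text{and}\qquad \deg(F_jQ_j)\le\deg\Phi\quad (j=1,\dots,m).$$ -/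

import Mathlib

open MvPolynomial

/-- Complex projective space `ℙⁿ`, with homogeneous coordinates `[z₀ : z₁ : ⋯ : zₙ]`. -/
abbrev ProjSpace (n : ℕ) : Type := Projectivization ℂ (Fin (n + 1) → ℂ)

/-- The common zeros in `ℙⁿ` of a set `S` of forms in `z₀, …, zₙ`. It is only used for sets of
homogeneous polynomials, for which it does not depend on the choice of representatives. -/
def projZeroLocus {n : ℕ} (S : Set (MvPolynomial (Fin (n + 1)) ℂ)) : Set (ProjSpace n) :=
  {p | ∀ g ∈ S, eval p.rep g = 0}

/-- The algebraic subsets of `ℙⁿ`: the zero sets of families of homogeneous polynomials. -/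
def IsProjAlgebraic {n : ℕ} (V : Set (ProjSpace n)) : Prop :=
  ∃ S : Set (MvPolynomial (Fin (n + 1)) ℂ),
    (∀ g ∈ S, ∃ k : ℕ, g.IsHomogeneous k) ∧ V = projZeroLocus S

theorem isProjAlgebraic_empty {n : ℕ} : IsProjAlgebraic (∅ : Set (ProjSpace n)) := by
  refine ⟨{1}, ?_, ?_⟩
  · rintro g rfl
    exact ⟨0, isHomogeneous_one _ _⟩
  · ext p
    simp [projZeroLocus]

theorem isProjAlgebraic_sInter {n : ℕ} (A : Set (Set (ProjSpace n)))
    (hA : A ⊆ {V | IsProjAlgebraic V}) : IsProjAlgebraic (⋂₀ A) := by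
  refine ⟨{g | (∃ k : ℕ, g.IsHomogeneous k) ∧ ∃ V ∈ A, ∀ p ∈ V, eval p.rep g = 0}, ?_, ?_⟩
  · rintro g ⟨hg, -⟩
    exact hg
  · ext p
    constructor
    · rintro hp g ⟨-, V, hV, hg⟩
      exact hg p (hp V hV)
    · intro hp V hV
      obtain ⟨S, hS, hVS⟩ := hA hV
      rw [hVS]
      intro g hg
      refine hp g ⟨hS g hg, V, hV, fun q hq => ?_⟩
      rw [hVS] at hq
      exact hq g hg

theorem isProjAlgebraic_union {n : ℕ} (V W : Set (ProjSpace n))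
    (hV : IsProjAlgebraic V) (hW : IsProjAlgebraic W) : IsProjAlgebraic (V ∪ W) := by
  obtain ⟨S, hS, rfl⟩ := hV
  obtain ⟨T, hT, rfl⟩ := hW
  refine ⟨{g | ∃ a ∈ S, ∃ b ∈ T, g = a * b}, ?_, ?_⟩
  · rintro g ⟨a, ha, b, hb, rfl⟩
    obtain ⟨k, hk⟩ := hS a ha
    obtain ⟨l, hl⟩ := hT b hb
    exact ⟨k + l, hk.mul hl⟩
  · ext p
    constructor
    · rintro (hp | hp) g ⟨a, ha, b, hb, rfl⟩
      · simp [hp a ha]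
      · simp [hp b hb]
    · intro hp
      by_contra hcon
      rw [Set.mem_union, not_or] at hcon
      obtain ⟨h1, h2⟩ := hcon
      simp only [projZeroLocus, Set.mem_ofPred_eq, not_forall] at h1 h2
      obtain ⟨a, ha, ha0⟩ := h1
      obtain ⟨b, hb, hb0⟩ := h2
      have h := hp (a * b) ⟨a, ha, b, hb, rfl⟩
      rw [map_mul] at h
      exact (mul_ne_zero ha0 hb0) h

/-- The Zariski topology on `ℙⁿ`: the closed sets are the algebraic sets. -/
instance zariskiTopology (n : ℕ) : TopologicalSpace (ProjSpace n) :=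
  TopologicalSpace.ofClosed {V | IsProjAlgebraic V} isProjAlgebraic_empty
    isProjAlgebraic_sInter (fun V hV W hW => isProjAlgebraic_union V W hV hW)

/-- The codimension in `ℙⁿ` of an algebraic set `Z`. An irreducible closed set `C` has
codimension the supremum of the lengths of chains `C = C₀ ⊊ C₁ ⊊ ⋯ ⊊ C_l` of irreducible closed
subsets of `ℙⁿ`; the codimension of `Z` is the least codimension of an irreducible closed subset
of `Z`. The empty set has codimension `⊤`. -/
noncomputable def projCodim {n : ℕ} (Z : Set (ProjSpace n)) : ℕ∞ :=
  ⨅ (C : TopologicalSpace.IrreducibleCloseds (ProjSpace n)) (_ : (C : Set (ProjSpace n)) ⊆ Z),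
    Order.coheight C

/-- The irreducible components of a subset `Z` of `ℙⁿ`: its maximal irreducible subsets. -/
def projIrreducibleComponents {n : ℕ} (Z : Set (ProjSpace n)) : Set (Set (ProjSpace n)) :=
  {C | Maximal (fun s => IsIrreducible s ∧ s ⊆ Z) C}

/-- The hyperplane at infinity `{z₀ = 0}` in `ℙⁿ`, the complement of `ℂⁿ`. -/
def hyperplaneAtInfinity (n : ℕ) : Set (ProjSpace n) :=
  projZeroLocus {X 0}

/-- The `d`-homogenization `z₀ᵈ F(z₁/z₀, …, zₙ/z₀)` of a polynomial `F` in `z₁, …, zₙ` with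
`deg F ≤ d`: the degree `k` part of `F` is multiplied by `z₀^(d - k)`. -/
noncomputable def homogenization {n : ℕ} (d : ℕ) (F : MvPolynomial (Fin n) ℂ) :
    MvPolynomial (Fin (n + 1)) ℂ :=
  ∑ k ∈ Finset.range (d + 1), X 0 ^ (d - k) * rename Fin.succ (homogeneousComponent k F)

/-- The projective zero set `{[z] ∈ ℙⁿ : f₁(z) = ⋯ = f_m(z) = 0}` of polynomials `F₁, …, F_m`
in `ℂⁿ`, where `f_j` is the `d_j`-homogenization of `F_j`. -/
def projZeroSet {n m : ℕ} (d : Fin m → ℕ) (F : Fin m → MvPolynomial (Fin n) ℂ) :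
    Set (ProjSpace n) :=
  projZeroLocus (Set.range fun j => homogenization (d j) (F j))

/-! Let `J` be the ideal of the homogenizations `f_j` in `ℂ[z₀, …, zₙ]`. Everything rests on `z₀`
being a nonzerodivisor on forms modulo `J`. If `Φ = ∑ A_j F_j`, homogenizing in a large degree puts
`z₀^N` times the homogenization of `Φ` in `J`; cancelling `z₀^N`, taking the part of degree `deg Φ`
and setting `z₀ = 1` gives the `Q_j` with the degree bound.

The cancellation is unmixedness in a Cohen-Macaulay ring. By projective Nullstellensatz, minimal
primes of `J` correspond to components of `Z`: each has height at least `m`, and none contains `z₀`.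
Hence every prime over `J + (z₀)` has height at least `m + 1`. In the local ring at the origin,
where the coordinates form a regular sequence, this makes `f_1, …, f_m, z₀` weakly regular
(`IsRegular.isWeaklyRegular_of_supportDim_le`). Homogeneity then removes the localization. -/

/-! ### Depth, dimension and systems of parameters over a Noetherian local ring. -/

section CohenMacaulay

open RingTheory.Sequence IsLocalRing Module
open scoped Pointwise

universe u

variable {R : Type u} [CommRing R] [IsNoetherianRing R] [IsLocalRing R]

/-- Induction on the sequence: `P` and the first element `x` lie in a common associated prime `Q` of
`M / xM`. Since `x ∉ P`, the dimension drops strictly from `R ⧸ P` to `R ⧸ Q`. -/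
theorem RingTheory.Sequence.IsRegular.length_le_ringKrullDim_quotient {rs : List R}
    {M : Type*} [AddCommGroup M] [Module R M] [Module.Finite R M] (h : IsRegular M rs)
    (hrs : ∀ r ∈ rs, r ∈ maximalIdeal R) {P : Ideal R} (hP : P ∈ associatedPrimes R M) :
    (rs.length : WithBot ℕ∞) ≤ ringKrullDim (R ⧸ P) := by
  induction rs generalizing M P with
  | nil =>
    have := hP.isPrime
    simpa using ringKrullDim_nonneg_of_nontrivial
  | cons x rs ih =>
    obtain ⟨hx, hreg⟩ := (isRegular_cons_iff M x rs).mp h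
    have hxm : x ∈ maximalIdeal R := hrs x List.mem_cons_self
    have hprime := hP.isPrime
    obtain ⟨m, hm⟩ := ((isAssociatedPrime_iff).mp hP).2
    have hm0 : m ≠ 0 := by
      rintro rfl
      apply hprime.ne_top
      simp [hm]
    have hPm : ∀ a, a ∈ P ↔ a • m = 0 := fun a => by
      rw [hm, Submodule.mem_colon_singleton, Submodule.mem_bot]
    let N : Submodule R M := Submodule.torsionBySet R M P
    have hmN : m ∈ N := (Submodule.mem_torsionBySet_iff _ _).mpr fun a => (hPm a).mp a.2
    -- If `N ⊆ xM`, regularity of `x` gives `N ⊆ xN`, and Nakayama forces `N = 0`, against `m ∈ N`.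
    obtain ⟨n, hn, hnx⟩ : ∃ n ∈ N, n ∉ x • (⊤ : Submodule R M) := by
      by_contra! hcon
      have hle : N ≤ Ideal.span {x} • N := by
        intro n hn
        obtain ⟨k, -, rfl⟩ := hcon n hn
        rw [Submodule.ideal_span_singleton_smul]
        refine Submodule.smul_mem_pointwise_smul _ _ _ ?_
        refine (Submodule.mem_torsionBySet_iff _ _).mpr fun a => hx ?_
        have := (Submodule.mem_torsionBySet_iff _ _).mp hn a
        simp only [DistribSMul.toLinearMap_apply] at this
        simpa [smul_comm x] using this
      have hbot : N = ⊥ := Submodule.eq_bot_of_le_smul_of_le_jacobson_bot _ N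
        (IsNoetherian.noetherian N) hle
        (((Ideal.span_singleton_le_iff_mem _).mpr hxm).trans (maximalIdeal_le_jacobson _))
      rw [hbot] at hmN
      exact hm0 ((Submodule.mem_bot R).mp hmN)
    have hn0 : (Submodule.Quotient.mk n : QuotSMulTop x M) ≠ 0 := by
      rwa [Ne, Submodule.Quotient.mk_eq_zero]
    obtain ⟨Q, hQ, hnQ⟩ := exists_le_isAssociatedPrime_of_isNoetherianRing R _ hn0
    have hPQ : P ≤ Q := fun a ha => hnQ <| by
      rw [Submodule.mem_colon_singleton, ← Submodule.Quotient.mk_smul,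
        (Submodule.mem_torsionBySet_iff _ _).mp hn ⟨a, ha⟩]
      simp
    have hxQ : x ∈ Q := hnQ <| by
      rw [Submodule.mem_colon_singleton, ← Submodule.Quotient.mk_smul, Submodule.mem_bot,
        Submodule.Quotient.mk_eq_zero]
      exact Submodule.smul_mem_pointwise_smul _ _ _ trivial
    have hxP : x ∉ P := fun hxP => hm0 (hx (by simpa using (hPm x).mp hxP))
    have hle := ih hreg (fun r hr => hrs r (List.mem_cons_of_mem _ hr)) hQ
    have hsucc : ringKrullDim (R ⧸ Q) + 1 ≤ ringKrullDim (R ⧸ P) :=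
      ringKrullDim_succ_le_of_surjective (Ideal.Quotient.factor hPQ)
        (Ideal.Quotient.factor_surjective hPQ)
        (r := Ideal.Quotient.mk P x)
        (mem_nonZeroDivisors_of_ne_zero (by rwa [Ne, Ideal.Quotient.eq_zero_iff_mem]))
        (by rwa [Ideal.Quotient.factor_mk, Ideal.Quotient.eq_zero_iff_mem])
    refine le_trans ?_ hsucc
    push_cast [List.length_cons]
    gcongr

-- Rees' criterion turns regular sequences into vanishing of `Ext` from the residue field. The long
-- exact sequence of multiplication by `y` loses only one degree of vanishing, whichever regular `y`
-- is chosen.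
open CategoryTheory Abelian in
theorem RingTheory.Sequence.IsRegular.exists_isRegular_quotSMulTop {rs : List R}
    {M : Type u} [AddCommGroup M] [Module R M] [Module.Finite R M] (h : IsRegular M rs)
    (hrs : ∀ r ∈ rs, r ∈ maximalIdeal R) {y : R} (hy : IsSMulRegular M y)
    (hym : y ∈ maximalIdeal R) :
    ∃ rs' : List R, rs'.length = rs.length - 1 ∧ (∀ r ∈ rs', r ∈ maximalIdeal R) ∧
      IsRegular (QuotSMulTop y M) rs' := by
  have := h.nontrivial
  have hlt : ∀ (L : Type u) [AddCommGroup L] [Module R L] [Module.Finite R L] [Nontrivial L],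
      maximalIdeal R • (⊤ : Submodule R L) < ⊤ := fun L _ _ _ _ => lt_top_iff_ne_top.mpr
    (Submodule.top_ne_ideal_smul_of_le_jacobson_annihilator (maximalIdeal_le_jacobson _)).symm
  have := nontrivial_quotSMulTop_of_mem_maximalIdeal M hym
  have hsupp : Module.support R (R ⧸ maximalIdeal R) =
      PrimeSpectrum.zeroLocus (maximalIdeal R) := by
    rw [Module.support_eq_zeroLocus, Ideal.annihilator_quotient]
  have hext := ModuleCat.subsingleton_ext_of_exists_isRegular (maximalIdeal R)
    (ModuleCat.of R (R ⧸ maximalIdeal R)) hsupp.subset (ModuleCat.of R M) (hlt M) rs hrs h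
  refine ModuleCat.exists_isRegular_of_exists_subsingleton_ext (maximalIdeal R) (rs.length - 1)
    (ModuleCat.of R (QuotSMulTop y M)) (hlt _) (ModuleCat.of R (R ⧸ maximalIdeal R)) hsupp ?_
  intro i hi
  have zero1 := AddCommGrpCat.isZero_of_iff_subsingleton.mpr (hext i (by omega))
  have zero2 := AddCommGrpCat.isZero_of_iff_subsingleton.mpr (hext (i + 1) (by omega))
  have hyM : IsSMulRegular (ModuleCat.of R M) y := hy
  exact AddCommGrpCat.subsingleton_of_isZero <| ShortComplex.Exact.isZero_of_both_zeros
    ((Ext.covariant_sequence_exact₃' (ModuleCat.of R (R ⧸ maximalIdeal R))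
      hyM.smulShortComplex_shortExact) i (i + 1) rfl)
    (zero1.eq_zero_of_src _) (zero2.eq_zero_of_tgt _)

theorem Module.supportDim_le_supportDim_quotient_ofList_add_length {rs : List R}
    {M : Type*} [AddCommGroup M] [Module R M] [Module.Finite R M]
    (hrs : ∀ r ∈ rs, r ∈ maximalIdeal R) :
    supportDim R M ≤
      supportDim R (M ⧸ (Ideal.ofList rs • ⊤ : Submodule R M)) + rs.length := by
  induction rs generalizing M with
  | nil =>
    rw [Ideal.ofList_nil, Submodule.bot_smul]
    simpa using (supportDim_eq_of_equiv (Submodule.quotEquivOfEqBot ⊥ rfl)).ge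
  | cons x rs ih =>
    have h1 := supportDim_le_supportDim_quotSMulTop_succ (M := M) (hrs x List.mem_cons_self)
    have h2 := ih (M := QuotSMulTop x M) fun r hr => hrs r (List.mem_cons_of_mem _ hr)
    rw [supportDim_eq_of_equiv (Submodule.quotOfListConsSMulTopEquivQuotSMulTopInner M x rs)]
    refine h1.trans ((add_le_add_left h2 1).trans ?_)
    rw [List.length_cons, Nat.cast_succ, add_assoc]

/-- A sequence of parameters on a Cohen-Macaulay module is weakly regular. The module is assumed
to have a regular sequence `zs`, and the dimension of its quotient by the parameters `rs` to be
at most `zs.length - rs.length`. -/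
theorem RingTheory.Sequence.IsRegular.isWeaklyRegular_of_supportDim_le {zs rs : List R}
    {M : Type u} [AddCommGroup M] [Module R M] [Module.Finite R M] (h : IsRegular M zs)
    (hzs : ∀ r ∈ zs, r ∈ maximalIdeal R) (hrs : ∀ r ∈ rs, r ∈ maximalIdeal R)
    (hdim : supportDim R (M ⧸ (Ideal.ofList rs • ⊤ : Submodule R M)) + rs.length ≤ zs.length) :
    IsWeaklyRegular M rs := by
  induction rs generalizing M zs with
  | nil => exact .nil R M
  | cons y rs ih =>
    have hym : y ∈ maximalIdeal R := hrs y List.mem_cons_self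
    have hrs' : ∀ r ∈ rs, r ∈ maximalIdeal R := fun r hr => hrs r (List.mem_cons_of_mem _ hr)
    rw [supportDim_eq_of_equiv (Submodule.quotOfListConsSMulTopEquivQuotSMulTopInner M y rs),
      List.length_cons, Nat.cast_succ, ← add_assoc] at hdim
    have hquot : supportDim R (QuotSMulTop y M) + 1 ≤ zs.length :=
      (add_le_add_left (supportDim_le_supportDim_quotient_ofList_add_length hrs') 1).trans hdim
    -- A zero divisor `y` lies in an associated prime `P`. Then `R ⧸ P` embeds in `M` and is killed
    -- by `y`, so `zs.length ≤ dim R ⧸ P ≤ dim M / yM`, contradicting `hquot`.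
    have hy : IsSMulRegular M y := by
      by_contra hy
      have hmem : y ∈ ⋃ p ∈ associatedPrimes R M, (p : Set R) := by
        rw [biUnion_associatedPrimes_eq_compl_regular]
        exact hy
      simp only [Set.mem_iUnion, SetLike.mem_coe, exists_prop] at hmem
      obtain ⟨P, hP, hyP⟩ := hmem
      have hlen := h.length_le_ringKrullDim_quotient hzs hP
      obtain ⟨-, g, hg⟩ := (isAssociatedPrime_iff_exists_injective_linearMap P M).mp hP
      have hsub : support R (R ⧸ P) ⊆ support R (QuotSMulTop y M) := by
        rw [support_quotSMulTop]
        refine Set.subset_inter (support_subset_of_injective g hg) fun Q hQ => ?_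
        rw [support_eq_zeroLocus, Ideal.annihilator_quotient] at hQ
        exact (PrimeSpectrum.mem_zeroLocus _ _).mpr (Set.singleton_subset_iff.mpr (hQ hyP))
      have hle : ringKrullDim (R ⧸ P) ≤ supportDim R (QuotSMulTop y M) := by
        rw [← supportDim_quotient_eq_ringKrullDim]
        exact Order.krullDim_le_of_strictMono (Set.inclusion hsub) fun _ _ hab => hab
      have hcon := (add_le_add_left (hlen.trans hle) 1).trans hquot
      norm_cast at hcon
      omega
    have := h.nontrivial
    have := nontrivial_quotSMulTop_of_mem_maximalIdeal M hym
    obtain ⟨zs', hlen, hzs', hreg⟩ := h.exists_isRegular_quotSMulTop hzs hy hym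
    refine .cons hy (ih hreg hzs' hrs' ?_)
    rw [hlen]
    cases zs with
    -- Here the truncated subtraction in `hlen` would break the bound, but `hquot` is impossible: `M
    -- / yM` is nonzero.
    | nil =>
      have h0 : supportDim R (QuotSMulTop y M) ≠ ⊥ := supportDim_ne_bot_of_nontrivial _ _
      lift supportDim R (QuotSMulTop y M) to ℕ∞ using h0 with k
      norm_cast at hquot
      simp at hquot
    | cons z zs =>
      rw [List.length_cons, Nat.cast_succ] at hdim
      rw [List.length_cons, Nat.add_sub_cancel]
      exact (ENat.WithBot.add_le_add_one_right_iff).mp hdim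

end CohenMacaulay

/-! ### Parameters in a polynomial ring, locally at the origin. -/

section Parameters

open RingTheory.Sequence IsLocalRing Module

/-- A chain of primes over `J` is extended downwards by a chain of length `k` ending at its smallest
member. -/
theorem ringKrullDim_quotient_add_le_of_forall_le_height {R : Type*} [CommRing R] {J : Ideal R}
    {k : ℕ} (h : ∀ P : Ideal R, P.IsPrime → J ≤ P → k ≤ P.height) :
    ringKrullDim (R ⧸ J) + k ≤ ringKrullDim R := by
  nontriviality R ⧸ J
  have : Nonempty (PrimeSpectrum.zeroLocus (R := R) J) := by
    rwa [Set.nonempty_coe_sort, Set.nonempty_iff_ne_empty, ne_eq,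
      PrimeSpectrum.zeroLocus_empty_iff_eq_top, ← ne_eq, ← Ideal.Quotient.nontrivial_iff]
  rw [ringKrullDim_quotient, Order.krullDim_eq_iSup_length, ← WithBot.coe_natCast,
    ← WithBot.coe_add, ENat.iSup_add]
  have hdim : ringKrullDim R ≠ ⊥ := by
    have := (Ideal.Quotient.mk J).domain_nontrivial
    exact Order.krullDim_ne_bot_iff.mpr inferInstance
  rw [← WithBot.coe_unbot _ hdim, WithBot.coe_le_coe, iSup_le_iff]
  intro l
  have hk := h l.head.1.asIdeal inferInstance l.head.2
  rw [PrimeSpectrum.height_eq_orderHeight] at hk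
  obtain ⟨p, hp, hlen⟩ := Order.exists_series_of_le_height _ hk
  have hle := Order.LTSeries.length_le_krullDim
    (p.smash (l.map Subtype.val (Subtype.strictMono_coe _)) (by rw [hp, LTSeries.head_map]))
  rw [← WithBot.coe_le_coe, WithBot.coe_unbot]
  refine le_trans (le_of_eq ?_) hle
  rw [RelSeries.smash_length, hlen, LTSeries.map_length]
  push_cast
  rw [add_comm]

theorem MvPolynomial.isWeaklyRegular_ofFn_X (K : Type*) [Field K] (N : ℕ) :
    IsWeaklyRegular (MvPolynomial (Fin N) K) (List.ofFn (X : Fin N → MvPolynomial (Fin N) K)) := by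
  refine ⟨fun i hi => ?_⟩
  rw [List.length_ofFn] at hi
  have hideal : Ideal.ofList ((List.ofFn (X : Fin N → MvPolynomial (Fin N) K)).take i) =
      Ideal.span (X '' {j : Fin N | (j : ℕ) < i}) := by
    rw [Ideal.ofList]
    congr 1
    ext f
    simp only [Set.mem_ofPred_eq, Set.mem_image, List.mem_take_iff_getElem, List.getElem_ofFn,
      List.length_ofFn]
    constructor
    · rintro ⟨j, hj, rfl⟩
      exact ⟨⟨j, by omega⟩, by simp; omega, rfl⟩
    · rintro ⟨j, hj, rfl⟩
      exact ⟨j, by omega, rfl⟩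
  -- Membership in an ideal generated by variables is tested monomial by monomial, and multiplying
  -- by a further variable leaves the exponents of those variables unchanged.
  rw [isSMulRegular_quotient_iff_mem_of_smul_mem, hideal]
  intro f hf
  simp only [smul_eq_mul, Ideal.mul_top, List.getElem_ofFn] at hf ⊢
  rw [mem_ideal_span_X_image] at hf ⊢
  intro m hm
  obtain ⟨j, hj, hne⟩ := hf (Finsupp.single ⟨i, hi⟩ 1 + m) (by
    rw [support_X_mul]
    exact Finset.mem_map_of_mem _ hm)
  refine ⟨j, hj, fun h0 => hne ?_⟩
  have hij : (⟨i, hi⟩ : Fin N) ≠ j := by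
    rintro rfl
    exact lt_irrefl i hj
  simp [h0, hij]

/-- Let `fs` be polynomials without constant term generating an ideal of height `fs.length`. An
element outside all minimal primes of this ideal is a nonzerodivisor modulo the ideal, locally at
the origin. -/
theorem MvPolynomial.exists_constantCoeff_ne_zero_mul_mem_of_mul_mem {K : Type*} [Field K] {N : ℕ}
    {fs : List (MvPolynomial (Fin N) K)} (hfs : ∀ f ∈ fs, constantCoeff f = 0)
    (hht : ∀ P ∈ (Ideal.ofList fs).minimalPrimes, fs.length ≤ P.height)
    {x : MvPolynomial (Fin N) K} (hx : constantCoeff x = 0)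
    (hxP : ∀ P ∈ (Ideal.ofList fs).minimalPrimes, x ∉ P)
    {g : MvPolynomial (Fin N) K} (hg : x * g ∈ Ideal.ofList fs) :
    ∃ s : MvPolynomial (Fin N) K, constantCoeff s ≠ 0 ∧ s * g ∈ Ideal.ofList fs := by
  let 𝔪 : Ideal (MvPolynomial (Fin N) K) := RingHom.ker constantCoeff
  have : 𝔪.IsPrime := RingHom.ker_isPrime _
  let A := Localization.AtPrime 𝔪
  let φ := algebraMap (MvPolynomial (Fin N) K) A
  have hmax : ∀ {f : MvPolynomial (Fin N) K}, constantCoeff f = 0 → φ f ∈ maximalIdeal A :=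
    fun hf => (IsLocalization.AtPrime.to_map_mem_maximal_iff A 𝔪 _).mpr ((RingHom.mem_ker).mpr hf)
  have hreg : IsRegular A ((List.ofFn (X : Fin N → MvPolynomial (Fin N) K)).map φ) := by
    refine (isWeaklyRegular_ofFn_X K N).isRegular_of_isLocalization_of_mem A 𝔪 fun f hf => ?_
    obtain ⟨j, rfl⟩ := List.mem_ofFn.mp hf
    exact (RingHom.mem_ker).mpr (constantCoeff_X K j)
  have hAdim : ringKrullDim A ≤ N := by
    rw [IsLocalization.AtPrime.ringKrullDim_eq_height 𝔪 A]
    refine Ideal.height_le_ringKrullDim_of_isPrime.trans ?_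
    simp
  let rs : List A := (fs ++ [x]).map φ
  have hrs : ∀ r ∈ rs, r ∈ maximalIdeal A := by
    intro r hr
    obtain ⟨f, hf, rfl⟩ := List.mem_map.mp hr
    rcases List.mem_append.mp hf with hf | hf
    · exact hmax (hfs f hf)
    · rw [List.mem_singleton.mp hf]
      exact hmax hx
  have hheight : ∀ P : Ideal A, P.IsPrime → Ideal.ofList rs ≤ P →
      (rs.length : ℕ∞) ≤ P.height := by
    intro P hP hle
    rw [← IsLocalization.height_under 𝔪.primeCompl P]
    have hle' : Ideal.ofList (fs ++ [x]) ≤ P.under (MvPolynomial (Fin N) K) := by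
      rwa [← Ideal.map_ofList, Ideal.map_le_iff_le_comap] at hle
    rw [Ideal.ofList_append, sup_le_iff, Ideal.ofList_singleton,
      Ideal.span_singleton_le_iff_mem] at hle'
    obtain ⟨Q, hQ, hQP⟩ := Ideal.exists_minimalPrimes_le hle'.1
    have := hQ.isPrime
    -- The inclusion is strict because `x` lies in the larger prime only; this supplies the extra
    -- unit of height.
    have hlt : Q < P.under (MvPolynomial (Fin N) K) :=
      lt_of_le_of_ne hQP fun h => hxP Q hQ (h ▸ hle'.2)
    refine le_trans ?_ (Ideal.height_add_one_le_of_lt_of_isPrime hlt)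
    simp only [rs, List.length_map, List.length_append, List.length_singleton, Nat.cast_add,
      Nat.cast_one]
    gcongr
    exact hht Q hQ
  have hweak : IsWeaklyRegular A rs := by
    refine hreg.isWeaklyRegular_of_supportDim_le ?_ hrs ?_
    · intro r hr
      obtain ⟨f, hf, rfl⟩ := List.mem_map.mp hr
      obtain ⟨j, rfl⟩ := List.mem_ofFn.mp hf
      exact hmax (constantCoeff_X K j)
    · rw [smul_eq_mul, Ideal.mul_top, supportDim_quotient_eq_ringKrullDim,
        List.length_map (as := List.ofFn _), List.length_ofFn]
      exact (ringKrullDim_quotient_add_le_of_forall_le_height hheight).trans hAdim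
  -- Placing `x` last makes the final regularity condition the desired cancellation modulo `fs`.
  have hlast := ((isWeaklyRegular_append_iff A (fs.map φ) [φ x]).mp
    (by simpa [rs] using hweak)).2
  rw [isWeaklyRegular_singleton_iff, isSMulRegular_quotient_iff_mem_of_smul_mem] at hlast
  have hmem := hlast (φ g) (by
    rw [smul_eq_mul, smul_eq_mul, Ideal.mul_top, ← map_mul, ← Ideal.map_ofList]
    exact Ideal.mem_map_of_mem φ hg)
  rw [smul_eq_mul, Ideal.mul_top, ← Ideal.map_ofList,
    IsLocalization.algebraMap_mem_map_algebraMap_iff 𝔪.primeCompl] at hmem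
  obtain ⟨s, hs, hsg⟩ := hmem
  exact ⟨s, fun h => hs ((RingHom.mem_ker).mpr h), hsg⟩

end Parameters

/-! ### Projective Nullstellensatz: components, minimal primes and codimension. -/

section ProjectiveZeroSets

attribute [local instance] MvPolynomial.gradedAlgebra

theorem MvPolynomial.IsHomogeneous.eval_smul {σ R : Type*} [CommSemiring R] {f : MvPolynomial σ R}
    {k : ℕ} (hf : f.IsHomogeneous k) (t : R) (x : σ → R) :
    eval (t • x) f = t ^ k * eval x f := by
  rw [eval_eq, eval_eq, Finset.mul_sum]
  refine Finset.sum_congr rfl fun d hd => ?_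
  have hdeg : ∑ i ∈ d.support, d i = k := by
    simp [← hf (mem_support_iff.mp hd), Finsupp.weight_apply, Finsupp.sum]
  simp only [Pi.smul_apply, smul_eq_mul, mul_pow, Finset.prod_mul_distrib, Finset.prod_pow_eq_pow_sum,
    hdeg]
  ring

theorem MvPolynomial.eval_homogeneousComponent_eq_zero {σ K : Type*} [Field K] [Infinite K]
    {f : MvPolynomial σ K} {x : σ → K} (h : ∀ t : K, eval (t • x) f = 0) (k : ℕ) :
    eval x (homogeneousComponent k f) = 0 := by
  -- The restriction of `f` to the line through `x`, as a polynomial in `t`; it vanishes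
  -- identically, so its coefficients do.
  let p : Polynomial K := ∑ i ∈ Finset.range (f.totalDegree + 1),
    Polynomial.C (eval x (homogeneousComponent i f)) * Polynomial.X ^ i
  have hp : p = 0 := by
    refine Polynomial.funext fun t => ?_
    rw [Polynomial.eval_zero, ← h t]
    conv_rhs => rw [← sum_homogeneousComponent f]
    simp only [p, Polynomial.eval_finsetSum, map_sum, Polynomial.eval_mul, Polynomial.eval_C,
      Polynomial.eval_pow, Polynomial.eval_X]
    refine Finset.sum_congr rfl fun i _ => ?_
    rw [(homogeneousComponent_isHomogeneous i f).eval_smul, mul_comm]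
  by_cases hk : k < f.totalDegree + 1
  · have hcoeff := congrArg (fun q => Polynomial.coeff q k) hp
    simpa [p, Polynomial.finsetSum_coeff, Polynomial.coeff_C_mul, Polynomial.coeff_X_pow, hk]
      using hcoeff
  · rw [homogeneousComponent_eq_zero _ _ (by omega), map_zero]

variable {n : ℕ}

/-- The affine cone over a subset of projective space. -/
def projCone (s : Set (ProjSpace n)) : Set (Fin (n + 1) → ℂ) :=
  {x | ∃ p ∈ s, ∃ t : ℂ, x = t • p.rep}

/-- The ideal of the polynomials vanishing on the affine cone over a subset of projective space. -/
noncomputable def projVanishingIdeal (s : Set (ProjSpace n)) :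
    Ideal (MvPolynomial (Fin (n + 1)) ℂ) :=
  vanishingIdeal ℂ (projCone s)

theorem mem_projVanishingIdeal {s : Set (ProjSpace n)} {g : MvPolynomial (Fin (n + 1)) ℂ} :
    g ∈ projVanishingIdeal s ↔ ∀ p ∈ s, ∀ t : ℂ, eval (t • p.rep) g = 0 := by
  simp only [projVanishingIdeal, mem_vanishingIdeal_iff]
  constructor
  · intro h p hp t
    exact h _ ⟨p, hp, t, rfl⟩
  · rintro h _ ⟨p, hp, t, rfl⟩
    exact h p hp t

theorem eval_rep_eq_zero_of_mem_projVanishingIdeal {s : Set (ProjSpace n)}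
    {g : MvPolynomial (Fin (n + 1)) ℂ} (hg : g ∈ projVanishingIdeal s) {p : ProjSpace n}
    (hp : p ∈ s) : eval p.rep g = 0 := by
  simpa using mem_projVanishingIdeal.mp hg p hp 1

theorem MvPolynomial.IsHomogeneous.mem_projVanishingIdeal {s : Set (ProjSpace n)}
    {g : MvPolynomial (Fin (n + 1)) ℂ} {k : ℕ} (hg : g.IsHomogeneous k)
    (h : ∀ p ∈ s, eval p.rep g = 0) : g ∈ projVanishingIdeal s :=
  _root_.mem_projVanishingIdeal.mpr fun p hp t => by rw [hg.eval_smul, h p hp, mul_zero]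

theorem projVanishingIdeal_anti {s t : Set (ProjSpace n)} (h : s ⊆ t) :
    projVanishingIdeal t ≤ projVanishingIdeal s := fun _ hg =>
  mem_projVanishingIdeal.mpr fun p hp => mem_projVanishingIdeal.mp hg p (h hp)

theorem isHomogeneous_projVanishingIdeal (s : Set (ProjSpace n)) :
    (projVanishingIdeal s).IsHomogeneous (homogeneousSubmodule (Fin (n + 1)) ℂ) := by
  intro k g hg
  have hcomp : (DirectSum.decompose (homogeneousSubmodule (Fin (n + 1)) ℂ) g k :
      MvPolynomial (Fin (n + 1)) ℂ) = homogeneousComponent k g :=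
    decomposition.decompose'_apply g k
  rw [hcomp]
  exact (homogeneousComponent_isHomogeneous k g).mem_projVanishingIdeal fun p hp =>
    eval_homogeneousComponent_eq_zero (mem_projVanishingIdeal.mp hg p hp) k

theorem constantCoeff_eq_zero_of_mem_projVanishingIdeal {s : Set (ProjSpace n)} (hs : s.Nonempty)
    {g : MvPolynomial (Fin (n + 1)) ℂ} (hg : g ∈ projVanishingIdeal s) :
    constantCoeff g = 0 := by
  obtain ⟨p, hp⟩ := hs
  have h := mem_projVanishingIdeal.mp hg p hp 0
  rwa [zero_smul, eval_zero] at h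

theorem isClosed_iff_isProjAlgebraic {V : Set (ProjSpace n)} :
    IsClosed V ↔ IsProjAlgebraic V := by
  rw [← isOpen_compl_iff]
  change IsProjAlgebraic Vᶜᶜ ↔ _
  rw [compl_compl]

theorem isClosed_projZeroLocus {S : Set (MvPolynomial (Fin (n + 1)) ℂ)}
    (hS : ∀ g ∈ S, ∃ k : ℕ, g.IsHomogeneous k) : IsClosed (projZeroLocus S) :=
  isClosed_iff_isProjAlgebraic.mpr ⟨S, hS, rfl⟩

theorem IsClosed.eq_projZeroLocus_projVanishingIdeal {V : Set (ProjSpace n)} (hV : IsClosed V) :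
    V = projZeroLocus {g | g ∈ projVanishingIdeal V ∧ ∃ k : ℕ, g.IsHomogeneous k} := by
  refine Set.Subset.antisymm
    (fun p hp g hg => eval_rep_eq_zero_of_mem_projVanishingIdeal hg.1 hp) ?_
  obtain ⟨S, hS, hVS⟩ : IsProjAlgebraic V := isClosed_iff_isProjAlgebraic.mp hV
  intro p hp
  rw [hVS]
  intro g hg
  obtain ⟨k, hk⟩ := hS g hg
  refine hp g ⟨hk.mem_projVanishingIdeal fun q hq => ?_, k, hk⟩
  rw [hVS] at hq
  exact hq g hg

/-- For a homogeneous ideal, primality may be tested on forms, and a product of two forms vanishing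
on `s` covers `s` by two closed sets. -/
theorem IsIrreducible.isPrime_projVanishingIdeal {s : Set (ProjSpace n)} (hs : IsIrreducible s) :
    (projVanishingIdeal s).IsPrime := by
  refine (isHomogeneous_projVanishingIdeal s).isPrime_of_homogeneous_mem_or_mem ?_ ?_
  · intro h
    have h1 := constantCoeff_eq_zero_of_mem_projVanishingIdeal hs.nonempty
      ((Ideal.eq_top_iff_one _).mp h)
    simp at h1
  · rintro a b ⟨k, hk⟩ ⟨l, hl⟩ hab
    rw [mem_homogeneousSubmodule] at hk hl
    have hclosed : ∀ {c : MvPolynomial (Fin (n + 1)) ℂ} {j : ℕ}, c.IsHomogeneous j →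
        IsClosed (projZeroLocus {c}) := fun hc =>
      isClosed_projZeroLocus (by rintro _ rfl; exact ⟨_, hc⟩)
    have hsub : s ⊆ projZeroLocus {a} ∪ projZeroLocus {b} := by
      intro p hp
      have h := eval_rep_eq_zero_of_mem_projVanishingIdeal hab hp
      rw [map_mul, mul_eq_zero] at h
      exact h.imp (fun h => by rintro _ rfl; exact h) (fun h => by rintro _ rfl; exact h)
    exact (isPreirreducible_iff_isClosed_union_isClosed.mp hs.isPreirreducible _ _
      (hclosed hk) (hclosed hl) hsub).imp
      (fun h => hk.mem_projVanishingIdeal fun p hp => h hp a rfl)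
      (fun h => hl.mem_projVanishingIdeal fun p hp => h hp b rfl)

/-- A closed set is recovered from its ideal, so strict chains above `C` give strict chains of
primes below its ideal. -/
theorem coheight_le_height_projVanishingIdeal
    (C : TopologicalSpace.IrreducibleCloseds (ProjSpace n)) :
    Order.coheight C ≤ (projVanishingIdeal (C : Set (ProjSpace n))).height := by
  let φ : TopologicalSpace.IrreducibleCloseds (ProjSpace n) →
      (PrimeSpectrum (MvPolynomial (Fin (n + 1)) ℂ))ᵒᵈ := fun C =>
    OrderDual.toDual ⟨projVanishingIdeal C, C.isIrreducible.isPrime_projVanishingIdeal⟩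
  have hmono : Monotone φ := fun C D h => projVanishingIdeal_anti h
  have hinj : Function.Injective φ := by
    intro C D h
    have hI : projVanishingIdeal (C : Set (ProjSpace n)) = projVanishingIdeal D :=
      congrArg PrimeSpectrum.asIdeal (OrderDual.toDual.injective h)
    refine TopologicalSpace.IrreducibleCloseds.ext ?_
    rw [C.isClosed.eq_projZeroLocus_projVanishingIdeal,
      D.isClosed.eq_projZeroLocus_projVanishingIdeal, hI]
  have h := Order.coheight_le_coheight_apply_of_strictMono φ (hmono.strictMono_of_injective hinj) C
  rwa [Order.coheight_toDual, ← PrimeSpectrum.height_eq_orderHeight] at h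

theorem exists_rep_smul_eq {x : Fin (n + 1) → ℂ} (hx : x ≠ 0) :
    ∃ (p : ProjSpace n) (t : ℂ), t ≠ 0 ∧ p.rep = t • x := by
  obtain ⟨t, ht⟩ := Projectivization.exists_smul_eq_mk_rep ℂ x hx
  exact ⟨_, t, t.ne_zero, ht.symm⟩

theorem eval_smul_eq_zero_of_mem {P : Ideal (MvPolynomial (Fin (n + 1)) ℂ)}
    (hP : P.IsHomogeneous (homogeneousSubmodule (Fin (n + 1)) ℂ)) {x : Fin (n + 1) → ℂ}
    (hx : ∀ g ∈ P, eval x g = 0) (t : ℂ) {g : MvPolynomial (Fin (n + 1)) ℂ} (hg : g ∈ P) :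
    eval (t • x) g = 0 := by
  rw [← sum_homogeneousComponent g, map_sum]
  refine Finset.sum_eq_zero fun i _ => ?_
  rw [(homogeneousComponent_isHomogeneous i g).eval_smul,
    hx _ (homogeneousComponent_mem_of_mem hP hg i), mul_zero]

/-- The projective Nullstellensatz for homogeneous prime ideals. -/
theorem projVanishingIdeal_projZeroLocus {P : Ideal (MvPolynomial (Fin (n + 1)) ℂ)}
    [P.IsPrime] (hP : P.IsHomogeneous (homogeneousSubmodule (Fin (n + 1)) ℂ))
    (hne : (projZeroLocus (P : Set (MvPolynomial (Fin (n + 1)) ℂ))).Nonempty) :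
    projVanishingIdeal (projZeroLocus (P : Set (MvPolynomial (Fin (n + 1)) ℂ))) = P := by
  have hcone : projCone (projZeroLocus (P : Set (MvPolynomial (Fin (n + 1)) ℂ))) =
      zeroLocus ℂ P := by
    ext x
    simp only [mem_zeroLocus_iff]
    constructor
    · rintro ⟨p, hp, t, rfl⟩ g hg
      exact eval_smul_eq_zero_of_mem hP hp t hg
    · intro hx
      by_cases hx0 : x = 0
      -- Nonemptiness is essential here: the cone over the empty set does not contain the origin.
      · obtain ⟨p, hp⟩ := hne
        exact ⟨p, hp, 0, by rw [hx0, zero_smul]⟩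
      · obtain ⟨p, t, ht, hpt⟩ := exists_rep_smul_eq hx0
        refine ⟨p, fun g hg => ?_, t⁻¹, by rw [hpt, inv_smul_smul₀ ht]⟩
        rw [hpt]
        exact eval_smul_eq_zero_of_mem hP hx t hg
  rw [projVanishingIdeal, hcone, IsPrime.vanishingIdeal_zeroLocus]

/-- Otherwise the affine zero set of `P` is at most the origin, where `g` vanishes, and the affine
Nullstellensatz puts `g` in `P`. -/
theorem nonempty_projZeroLocus_of_constantCoeff_eq_zero_of_notMem
    {P : Ideal (MvPolynomial (Fin (n + 1)) ℂ)} [P.IsPrime]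
    (hP : P.IsHomogeneous (homogeneousSubmodule (Fin (n + 1)) ℂ))
    {g : MvPolynomial (Fin (n + 1)) ℂ} (hg : constantCoeff g = 0) (hgP : g ∉ P) :
    (projZeroLocus (P : Set (MvPolynomial (Fin (n + 1)) ℂ))).Nonempty := by
  by_contra hempty
  apply hgP
  rw [← IsPrime.vanishingIdeal_zeroLocus (K := ℂ) P]
  intro x hx
  simp only [mem_zeroLocus_iff] at hx ⊢
  by_cases hx0 : x = 0
  · rw [hx0, aeval_zero, hg, map_zero]
  · obtain ⟨p, t, ht, hpt⟩ := exists_rep_smul_eq hx0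
    refine absurd ⟨p, fun g hg => ?_⟩ hempty
    rw [hpt]
    exact eval_smul_eq_zero_of_mem hP hx t hg

theorem isClosed_projZeroLocus_coe {P : Ideal (MvPolynomial (Fin (n + 1)) ℂ)}
    (hP : P.IsHomogeneous (homogeneousSubmodule (Fin (n + 1)) ℂ)) :
    IsClosed (projZeroLocus (P : Set (MvPolynomial (Fin (n + 1)) ℂ))) := by
  have heq : projZeroLocus (P : Set (MvPolynomial (Fin (n + 1)) ℂ)) =
      projZeroLocus {g | g ∈ P ∧ ∃ k : ℕ, g.IsHomogeneous k} := by
    refine Set.Subset.antisymm (fun p hp g hg => hp g hg.1) fun p hp g hg => ?_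
    rw [← sum_homogeneousComponent g, map_sum]
    exact Finset.sum_eq_zero fun i _ => hp _ ⟨homogeneousComponent_mem_of_mem hP hg i, i,
      homogeneousComponent_isHomogeneous i g⟩
  rw [heq]
  exact isClosed_projZeroLocus fun g hg => hg.2

theorem isIrreducible_projZeroLocus {P : Ideal (MvPolynomial (Fin (n + 1)) ℂ)}
    [hprime : P.IsPrime] (hP : P.IsHomogeneous (homogeneousSubmodule (Fin (n + 1)) ℂ))
    (hne : (projZeroLocus (P : Set (MvPolynomial (Fin (n + 1)) ℂ))).Nonempty) :
    IsIrreducible (projZeroLocus (P : Set (MvPolynomial (Fin (n + 1)) ℂ))) := by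
  refine ⟨hne, isPreirreducible_iff_isClosed_union_isClosed.mpr fun V W hV hW hsub => ?_⟩
  by_contra! hcon
  have hexists : ∀ {V : Set (ProjSpace n)}, IsClosed V →
      ¬ projZeroLocus (P : Set (MvPolynomial (Fin (n + 1)) ℂ)) ⊆ V →
      ∃ a ∈ projVanishingIdeal V, a ∉ P := by
    intro V hV hnot
    by_contra! hle
    apply hnot
    rw [hV.eq_projZeroLocus_projVanishingIdeal]
    exact fun p hp g hg => hp g (hle g hg.1)
  obtain ⟨a, haV, haP⟩ := hexists hV hcon.1
  obtain ⟨b, hbW, hbP⟩ := hexists hW hcon.2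
  refine (hprime.mul_mem_iff_mem_or_mem.not.mpr (not_or.mpr ⟨haP, hbP⟩) : a * b ∉ P) ?_
  rw [← projVanishingIdeal_projZeroLocus hP hne, mem_projVanishingIdeal]
  intro p hp t
  rw [map_mul, mul_eq_zero]
  exact (hsub hp).imp (fun h => mem_projVanishingIdeal.mp haV p h t)
    (fun h => mem_projVanishingIdeal.mp hbW p h t)

theorem nonempty_of_projCodim_ne_top {Z : Set (ProjSpace n)} (hZ : projCodim Z ≠ ⊤) :
    Z.Nonempty := by
  by_contra hempty
  rw [Set.not_nonempty_iff_eq_empty] at hempty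
  apply hZ
  rw [projCodim, iInf₂_eq_top]
  intro C hC
  obtain ⟨p, hp⟩ := C.isIrreducible.nonempty
  exact absurd (hempty ▸ hC hp) (Set.notMem_empty p)

theorem isHomogeneous_span_of_forall_isHomogeneous {S : Set (MvPolynomial (Fin (n + 1)) ℂ)}
    (hS : ∀ g ∈ S, ∃ k : ℕ, g.IsHomogeneous k) :
    (Ideal.span S).IsHomogeneous (homogeneousSubmodule (Fin (n + 1)) ℂ) :=
  Ideal.homogeneous_span _ _ fun g hg =>
    (hS g hg).imp fun k hk => (mem_homogeneousSubmodule k g).mpr hk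

theorem span_le_projVanishingIdeal {S : Set (MvPolynomial (Fin (n + 1)) ℂ)}
    (hS : ∀ g ∈ S, ∃ k : ℕ, g.IsHomogeneous k) {s : Set (ProjSpace n)} (hs : s ⊆ projZeroLocus S) :
    Ideal.span S ≤ projVanishingIdeal s := Ideal.span_le.mpr fun g hg => by
  obtain ⟨k, hk⟩ := hS g hg
  exact hk.mem_projVanishingIdeal fun p hp => hs hp g hg

/-- The homogeneous core of a prime is prime and still contains the homogeneous ideal, so minimality
makes it all of `P`. -/
theorem isHomogeneous_of_mem_minimalPrimes_span {S : Set (MvPolynomial (Fin (n + 1)) ℂ)}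
    (hS : ∀ g ∈ S, ∃ k : ℕ, g.IsHomogeneous k) {P : Ideal (MvPolynomial (Fin (n + 1)) ℂ)}
    (hP : P ∈ (Ideal.span S).minimalPrimes) :
    P.IsHomogeneous (homogeneousSubmodule (Fin (n + 1)) ℂ) := by
  have hcore : (Ideal.homogeneousCore (homogeneousSubmodule (Fin (n + 1)) ℂ) P).toIdeal ≤ P :=
    Ideal.toIdeal_homogeneousCore_le _ _
  have hle := hP.2 ⟨hP.isPrime.homogeneousCore, by
    rw [← (isHomogeneous_span_of_forall_isHomogeneous hS).toIdeal_homogeneousCore_eq_self]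
    exact Ideal.homogeneousCore_mono _ hP.1.2⟩ hcore
  rw [le_antisymm hle hcore]
  exact HomogeneousIdeal.isHomogeneous _

theorem nonempty_projZeroLocus_of_mem_minimalPrimes {S : Set (MvPolynomial (Fin (n + 1)) ℂ)}
    (hS : ∀ g ∈ S, ∃ k : ℕ, g.IsHomogeneous k) {P : Ideal (MvPolynomial (Fin (n + 1)) ℂ)}
    (hP : P ∈ (Ideal.span S).minimalPrimes) (hne : (projZeroLocus S).Nonempty) :
    (projZeroLocus (P : Set (MvPolynomial (Fin (n + 1)) ℂ))).Nonempty := by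
  have := hP.isPrime
  obtain ⟨p, hp⟩ := hne
  by_contra hempty
  have hmem : ∀ g : MvPolynomial (Fin (n + 1)) ℂ, constantCoeff g = 0 → g ∈ P := fun g hg => by
    by_contra hgP
    exact hempty (nonempty_projZeroLocus_of_constantCoeff_eq_zero_of_notMem
      (isHomogeneous_of_mem_minimalPrimes_span hS hP) hg hgP)
  -- Now `P` contains the irrelevant ideal, hence the prime ideal of the point `p`; minimality
  -- reverses this, and every coordinate of `p` would vanish.
  have hle : P ≤ projVanishingIdeal {p} :=
    hP.2 ⟨(isIrreducible_singleton).isPrime_projVanishingIdeal,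
      span_le_projVanishingIdeal hS (Set.singleton_subset_iff.mpr hp)⟩ fun g hg =>
        hmem g (constantCoeff_eq_zero_of_mem_projVanishingIdeal (Set.singleton_nonempty p) hg)
  refine p.rep_nonzero (funext fun i => ?_)
  simpa using eval_rep_eq_zero_of_mem_projVanishingIdeal
    (hle (hmem (X i) (constantCoeff_X ℂ i))) (Set.mem_singleton p)

theorem projZeroLocus_subset_of_span_le {S : Set (MvPolynomial (Fin (n + 1)) ℂ)}
    {P : Ideal (MvPolynomial (Fin (n + 1)) ℂ)} (hle : Ideal.span S ≤ P) :
    projZeroLocus (P : Set (MvPolynomial (Fin (n + 1)) ℂ)) ⊆ projZeroLocus S :=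
  fun _ hp g hg => hp g (hle (Ideal.subset_span hg))

theorem projCodim_le_height_of_mem_minimalPrimes {S : Set (MvPolynomial (Fin (n + 1)) ℂ)}
    (hS : ∀ g ∈ S, ∃ k : ℕ, g.IsHomogeneous k) {P : Ideal (MvPolynomial (Fin (n + 1)) ℂ)}
    (hP : P ∈ (Ideal.span S).minimalPrimes) (hne : (projZeroLocus S).Nonempty) :
    projCodim (projZeroLocus S) ≤ P.height := by
  have := hP.isPrime
  have hhom := isHomogeneous_of_mem_minimalPrimes_span hS hP
  have hneP := nonempty_projZeroLocus_of_mem_minimalPrimes hS hP hne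
  let C : TopologicalSpace.IrreducibleCloseds (ProjSpace n) :=
    ⟨_, isIrreducible_projZeroLocus hhom hneP, isClosed_projZeroLocus_coe hhom⟩
  refine (iInf₂_le C (projZeroLocus_subset_of_span_le hP.1.2)).trans
    ((coheight_le_height_projVanishingIdeal C).trans (le_of_eq ?_))
  exact congrArg Ideal.height (projVanishingIdeal_projZeroLocus hhom hneP)

theorem projZeroLocus_mem_projIrreducibleComponents {S : Set (MvPolynomial (Fin (n + 1)) ℂ)}
    (hS : ∀ g ∈ S, ∃ k : ℕ, g.IsHomogeneous k) {P : Ideal (MvPolynomial (Fin (n + 1)) ℂ)}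
    (hP : P ∈ (Ideal.span S).minimalPrimes) (hne : (projZeroLocus S).Nonempty) :
    projZeroLocus (P : Set (MvPolynomial (Fin (n + 1)) ℂ)) ∈
      projIrreducibleComponents (projZeroLocus S) := by
  have := hP.isPrime
  have hhom := isHomogeneous_of_mem_minimalPrimes_span hS hP
  have hneP := nonempty_projZeroLocus_of_mem_minimalPrimes hS hP hne
  refine ⟨⟨isIrreducible_projZeroLocus hhom hneP, projZeroLocus_subset_of_span_le hP.1.2⟩, ?_⟩
  rintro s ⟨hs, hsZ⟩ hPs p hp g hg
  have hle : projVanishingIdeal s ≤ P := by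
    conv_rhs => rw [← projVanishingIdeal_projZeroLocus hhom hneP]
    exact projVanishingIdeal_anti hPs
  exact eval_rep_eq_zero_of_mem_projVanishingIdeal
    (hP.2 ⟨hs.isPrime_projVanishingIdeal, span_le_projVanishingIdeal hS hsZ⟩ hle hg) hp

end ProjectiveZeroSets

/-! ### Homogenization and dehomogenization. -/

section Homogenization

attribute [local instance] MvPolynomial.gradedAlgebra

theorem MvPolynomial.IsHomogeneous.homogeneousComponent_mul {σ R : Type*} [CommSemiring R]
    {f : MvPolynomial σ R} {d : ℕ} (hf : f.IsHomogeneous d) (g : MvPolynomial σ R) (k : ℕ) :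
    homogeneousComponent k (f * g) = if d ≤ k then f * homogeneousComponent (k - d) g else 0 := by
  have hcomp : ∀ (h : MvPolynomial σ R) (i : ℕ), homogeneousComponent i h =
      (DirectSum.decompose (homogeneousSubmodule σ R) h i : MvPolynomial σ R) :=
    fun h i => (decomposition.decompose'_apply h i).symm
  have hmem : f ∈ homogeneousSubmodule σ R d := (mem_homogeneousSubmodule d f).mpr hf
  rw [hcomp, hcomp]
  split_ifs with hdk
  · exact DirectSum.coe_decompose_mul_of_left_mem_of_le _ hmem hdk
  · exact DirectSum.coe_decompose_mul_of_left_mem_of_not_le _ hmem hdk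

variable {n : ℕ}

theorem isHomogeneous_homogenization (d : ℕ) (F : MvPolynomial (Fin n) ℂ) :
    (homogenization d F).IsHomogeneous d := by
  refine IsHomogeneous.sum _ _ _ fun k hk => ?_
  have hk' : d - k + k = d := Nat.sub_add_cancel (Nat.lt_succ_iff.mp (Finset.mem_range.mp hk))
  have h := (isHomogeneous_X_pow (R := ℂ) (0 : Fin (n + 1)) (d - k)).mul
    ((homogeneousComponent_isHomogeneous k F).rename_isHomogeneous (f := Fin.succ))
  rwa [hk'] at h

/-- The dehomogenization `f(1, z₁, …, zₙ)` of a polynomial `f` in `z₀, …, zₙ`. -/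
noncomputable def dehomogenization :
    MvPolynomial (Fin (n + 1)) ℂ →ₐ[ℂ] MvPolynomial (Fin n) ℂ :=
  aeval (Fin.cons 1 X)

@[simp]
theorem dehomogenization_X_zero :
    dehomogenization (X 0 : MvPolynomial (Fin (n + 1)) ℂ) = 1 := by
  simp [dehomogenization]

theorem dehomogenization_rename_succ (F : MvPolynomial (Fin n) ℂ) :
    dehomogenization (rename Fin.succ F) = F := by
  have hcomp : (Fin.cons 1 X : Fin (n + 1) → MvPolynomial (Fin n) ℂ) ∘ Fin.succ = X := by
    ext i
    simp
  rw [dehomogenization, aeval_rename, hcomp, aeval_X_left_apply]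

theorem dehomogenization_homogenization {d : ℕ} {F : MvPolynomial (Fin n) ℂ}
    (hF : F.totalDegree ≤ d) : dehomogenization (homogenization d F) = F := by
  simp only [homogenization, map_sum, map_mul, map_pow, dehomogenization_X_zero, one_pow, one_mul,
    dehomogenization_rename_succ]
  conv_rhs => rw [← sum_homogeneousComponent F]
  refine (Finset.sum_subset (Finset.range_mono (by omega)) fun k _ hk => ?_).symm
  exact homogeneousComponent_eq_zero _ _ (by simpa using hk)

theorem totalDegree_dehomogenization_le {k : ℕ} {q : MvPolynomial (Fin (n + 1)) ℂ}
    (hq : q.IsHomogeneous k) : (dehomogenization q).totalDegree ≤ k := by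
  rw [dehomogenization, aeval_def, eval₂_eq]
  refine totalDegree_finsetSum_le fun d hd => ?_
  have hdeg : ∑ i ∈ d.support, d i = k := by
    simp [← hq (mem_support_iff.mp hd), Finsupp.weight_apply, Finsupp.sum]
  refine (totalDegree_mul _ _).trans ?_
  rw [algebraMap_eq, totalDegree_C, zero_add, ← hdeg]
  refine (totalDegree_finsetProd _ _).trans (Finset.sum_le_sum fun i _ => ?_)
  refine (totalDegree_pow _ _).trans ?_
  have hle : ((Fin.cons 1 X : Fin (n + 1) → MvPolynomial (Fin n) ℂ) i).totalDegree ≤ 1 := by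
    refine Fin.cases ?_ (fun j => ?_) i
    · simp
    · simp
  calc d i * _ ≤ d i * 1 := Nat.mul_le_mul_left _ hle
    _ = d i := mul_one _

theorem eval_eq_zero_of_dehomogenization_eq_zero {k : ℕ} {q : MvPolynomial (Fin (n + 1)) ℂ}
    (hq : q.IsHomogeneous k) (h : dehomogenization q = 0) {x : Fin (n + 1) → ℂ} (hx : x 0 ≠ 0) :
    eval x q = 0 := by
  let y : Fin n → ℂ := fun i => (x 0)⁻¹ * x i.succ
  have hxy : x = x 0 • (Fin.cons 1 y : Fin (n + 1) → ℂ) := by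
    ext i
    refine Fin.cases ?_ (fun j => ?_) i
    · simp
    · simp [y, hx]
  have hy : eval (Fin.cons 1 y) q = eval y (dehomogenization q) := by
    rw [dehomogenization, ← coe_aeval_eq_eval, ← coe_aeval_eq_eval, RingHom.coe_coe, RingHom.coe_coe,
      ← AlgHom.comp_apply, comp_aeval]
    congr 2
    ext i
    refine Fin.cases ?_ (fun j => ?_) i
    · simp
    · simp
  rw [hxy, hq.eval_smul, hy, h, map_zero, mul_zero]

/-- By scaling, `p - q` vanishes wherever `z₀ ≠ 0`, so `z₀ (p - q)` vanishes everywhere. -/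
theorem MvPolynomial.IsHomogeneous.eq_of_dehomogenization_eq {k : ℕ}
    {p q : MvPolynomial (Fin (n + 1)) ℂ} (hp : p.IsHomogeneous k) (hq : q.IsHomogeneous k)
    (h : dehomogenization p = dehomogenization q) : p = q := by
  have hsub : (X 0 : MvPolynomial (Fin (n + 1)) ℂ) * (p - q) = 0 := by
    refine MvPolynomial.funext fun x => ?_
    rw [map_mul, eval_X, map_zero, mul_eq_zero, or_iff_not_imp_left]
    exact eval_eq_zero_of_dehomogenization_eq_zero (hp.sub hq) (by rw [map_sub, h, sub_self])
  exact sub_eq_zero.mp ((mul_eq_zero.mp hsub).resolve_left (X_ne_zero 0))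

/-- If `z₀` is a nonzerodivisor on forms modulo the ideal of the homogenizations of the `F j`,
then this ideal contains the homogenization of every member of the ideal of the `F j`. -/
theorem homogenization_mem_span_of_mem_span {m : ℕ} {F : Fin m → MvPolynomial (Fin n) ℂ}
    {d : Fin m → ℕ} (hd : ∀ j, (F j).totalDegree ≤ d j)
    (hX : ∀ (g : MvPolynomial (Fin (n + 1)) ℂ) (k : ℕ), g.IsHomogeneous k →
      X 0 * g ∈ Ideal.span (Set.range fun j => homogenization (d j) (F j)) →
      g ∈ Ideal.span (Set.range fun j => homogenization (d j) (F j)))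
    {Φ : MvPolynomial (Fin n) ℂ} (hΦ : Φ ∈ Ideal.span (Set.range F)) :
    homogenization Φ.totalDegree Φ ∈
      Ideal.span (Set.range fun j => homogenization (d j) (F j)) := by
  obtain ⟨A, hA⟩ := (Ideal.mem_span_range_iff_exists_fun).mp hΦ
  -- A common degree large enough to homogenize `Φ` and every product `A j * F j`.
  let D := Φ.totalDegree + ∑ j, (d j + (A j).totalDegree)
  have hD : ∀ j, d j + (A j).totalDegree ≤ D := fun j =>
    (Finset.single_le_sum (f := fun j => d j + (A j).totalDegree) (fun _ _ => Nat.zero_le _)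
      (Finset.mem_univ j)).trans (Nat.le_add_left _ _)
  have hDΦ : D - Φ.totalDegree + Φ.totalDegree = D := Nat.sub_add_cancel (Nat.le_add_right _ _)
  have heq : X 0 ^ (D - Φ.totalDegree) * homogenization Φ.totalDegree Φ =
      ∑ j, homogenization (d j) (F j) * homogenization (D - d j) (A j) := by
    refine IsHomogeneous.eq_of_dehomogenization_eq (k := D) ?_ ?_ ?_
    · have h := (isHomogeneous_X_pow (R := ℂ) (0 : Fin (n + 1)) (D - Φ.totalDegree)).mul
        (isHomogeneous_homogenization Φ.totalDegree Φ)
      rwa [hDΦ] at h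
    · refine IsHomogeneous.sum _ _ _ fun j _ => ?_
      have h := (isHomogeneous_homogenization (d j) (F j)).mul
        (isHomogeneous_homogenization (D - d j) (A j))
      have := hD j
      rwa [Nat.add_sub_cancel' (by omega)] at h
    · rw [map_mul, map_pow, dehomogenization_X_zero, one_pow, one_mul,
        dehomogenization_homogenization le_rfl, map_sum, ← hA]
      refine Finset.sum_congr rfl fun j _ => ?_
      have := hD j
      rw [map_mul, dehomogenization_homogenization (hd j),
        dehomogenization_homogenization (by omega), mul_comm]
  have hmem : X 0 ^ (D - Φ.totalDegree) * homogenization Φ.totalDegree Φ ∈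
      Ideal.span (Set.range fun j => homogenization (d j) (F j)) := by
    rw [heq]
    exact Ideal.sum_mem _ fun j _ => Ideal.mul_mem_right _ _ (Ideal.subset_span ⟨j, rfl⟩)
  generalize D - Φ.totalDegree = N at hmem
  induction N with
  | zero => simpa using hmem
  | succ N ih =>
    refine ih (hX _ _ ((isHomogeneous_X_pow (R := ℂ) (0 : Fin (n + 1)) N).mul
      (isHomogeneous_homogenization Φ.totalDegree Φ)) ?_)
    rwa [← mul_assoc, ← pow_succ']

end Homogenization

/-! ### Cancelling `z₀` and the degree bound. -/

theorem mem_span_homogenization_of_X_zero_mul_mem {n m : ℕ} {F : Fin m → MvPolynomial (Fin n) ℂ}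
    {d : Fin m → ℕ} (hcodim : projCodim (projZeroSet d F) = m)
    (hinf : ∀ C ∈ projIrreducibleComponents (projZeroSet d F), ¬ C ⊆ hyperplaneAtInfinity n)
    {g : MvPolynomial (Fin (n + 1)) ℂ} {k : ℕ} (hg : g.IsHomogeneous k)
    (hXg : X 0 * g ∈ Ideal.span (Set.range fun j => homogenization (d j) (F j))) :
    g ∈ Ideal.span (Set.range fun j => homogenization (d j) (F j)) := by
  have hS : ∀ f ∈ Set.range fun j => homogenization (d j) (F j), ∃ k : ℕ, f.IsHomogeneous k := by
    rintro _ ⟨j, rfl⟩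
    exact ⟨_, isHomogeneous_homogenization _ _⟩
  have hne : (projZeroSet d F).Nonempty :=
    nonempty_of_projCodim_ne_top (by rw [hcodim]; exact ENat.natCast_ne_top m)
  have hlist : Ideal.ofList (List.ofFn fun j => homogenization (d j) (F j)) =
      Ideal.span (Set.range fun j => homogenization (d j) (F j)) := by
    rw [Ideal.ofList]
    congr 1
    ext f
    simp [List.mem_ofFn]
  rw [← hlist] at hXg
  have hcoeff : ∀ f ∈ List.ofFn fun j => homogenization (d j) (F j), constantCoeff f = 0 := by
    intro f hf
    obtain ⟨j, rfl⟩ := List.mem_ofFn.mp hf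
    exact constantCoeff_eq_zero_of_mem_projVanishingIdeal hne
      (span_le_projVanishingIdeal hS subset_rfl (Ideal.subset_span ⟨j, rfl⟩))
  have hheight : ∀ P ∈ (Ideal.ofList (List.ofFn fun j =>
      homogenization (d j) (F j))).minimalPrimes,
      ((List.ofFn fun j => homogenization (d j) (F j)).length : ℕ∞) ≤ P.height := by
    intro P hP
    rw [hlist] at hP
    rw [List.length_ofFn, ← hcodim]
    exact projCodim_le_height_of_mem_minimalPrimes hS hP hne
  have hX : ∀ P ∈ (Ideal.ofList (List.ofFn fun j => homogenization (d j) (F j))).minimalPrimes,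
      X 0 ∉ P := by
    intro P hP hXP
    rw [hlist] at hP
    refine hinf _ (projZeroLocus_mem_projIrreducibleComponents hS hP hne) fun p hp f hf => ?_
    rw [Set.mem_singleton_iff.mp hf]
    exact hp _ hXP
  obtain ⟨s, hs, hsg⟩ := exists_constantCoeff_ne_zero_mul_mem_of_mul_mem hcoeff hheight
    (constantCoeff_X ℂ 0) hX hXg
  rw [hlist] at hsg
  -- As `g` is a form of degree `k`, the degree `k` part of `s * g` is the nonzero constant term of
  -- `s` times `g`.
  have h := homogeneousComponent_mem_of_mem (isHomogeneous_span_of_forall_isHomogeneous hS) hsg k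
  rw [mul_comm, hg.homogeneousComponent_mul, if_pos le_rfl, Nat.sub_self,
    homogeneousComponent_zero] at h
  have h' := Ideal.mul_mem_left _ (C (constantCoeff s)⁻¹) h
  rwa [mul_left_comm, ← C_mul, ← constantCoeff_eq, inv_mul_cancel₀ hs, C_1, mul_one] at h'

theorem theorem1p2 (n m : ℕ) (F : Fin m → MvPolynomial (Fin n) ℂ) (d : Fin m → ℕ)
    (hd : ∀ j, (F j).totalDegree ≤ d j)
    (hcodim : projCodim (projZeroSet d F) = m)
    (hinf : ∀ C ∈ projIrreducibleComponents (projZeroSet d F), ¬ C ⊆ hyperplaneAtInfinity n)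
    (Φ : MvPolynomial (Fin n) ℂ) (hΦ : Φ ∈ Ideal.span (Set.range F)) :
    ∃ Q : Fin m → MvPolynomial (Fin n) ℂ,
      Φ = ∑ j, F j * Q j ∧ ∀ j, (F j * Q j).totalDegree ≤ Φ.totalDegree := by
  have hmem := homogenization_mem_span_of_mem_span hd
    (fun g k hg => mem_span_homogenization_of_X_zero_mul_mem hcodim hinf hg) hΦ
  obtain ⟨B, hB⟩ := (Ideal.mem_span_range_iff_exists_fun).mp hmem
  -- Only the degree `deg Φ` part of the identity `hB` is kept; a generator with `d j > deg Φ`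
  -- contributes nothing to it.
  refine ⟨fun j => if d j ≤ Φ.totalDegree then
    dehomogenization (homogeneousComponent (Φ.totalDegree - d j) (B j)) else 0, ?_, fun j => ?_⟩
  · have h := congrArg (fun p => dehomogenization (homogeneousComponent Φ.totalDegree p)) hB
    simp only [map_sum] at h
    rw [homogeneousComponent_eq_self (isHomogeneous_homogenization _ _),
      dehomogenization_homogenization le_rfl] at h
    refine h.symm.trans (Finset.sum_congr rfl fun j _ => ?_)
    rw [mul_comm (B j), (isHomogeneous_homogenization _ _).homogeneousComponent_mul]
    dsimp only
    split_ifs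
    · rw [map_mul, dehomogenization_homogenization (hd j)]
    · rw [map_zero, mul_zero]
  · dsimp only
    split_ifs with hj
    · have h := totalDegree_dehomogenization_le
        (homogeneousComponent_isHomogeneous (Φ.totalDegree - d j) (B j))
      have := hd j
      refine (totalDegree_mul _ _).trans ?_
      omega
    · simp
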